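/- Let $m\ge 1$, let $n_1,\dots,n_m$ be positive integers, put $n_{m+1}=n_1$, and let $j,r$ be non-negative integers with $j\le m$. Write $[n]=1+q+\cdots+q^{n-1}$ (so $[0]=0$, and $[0]^0=1$), and for an integer $n\ge 0$ write ${n\brack k}=\prod_{i=1}^k\frac{1-q^{n-i+1}}{1-q^i}$ if $k\ge 0$ and ${n\brack k}=0$ if $k<0$. For a polynomial $D\in\mathbb{Z}[q]$ and Laurent polynomials $A,B\in\mathbb{Z}[q,q^{-1}]$, write $A\equiv B \pmod D$ if $A-B=D\cdot P$ for some $P\in\mathbb{Z}[q,q^{-1}]$. Then $$\sum_{k=0}^{n_1} q^{j(k^2+k)-(r+1)k}[2k+1][k]^r[k+1]^r\prod_{i=1}^m {n_i+n_{i+1}+1\brack n_i-k}\equiv 0 \pmod{[n_1+n_m+1]{n_1+n_m\brack n_1}[n_1]^{\min\{1,r\}}[n_m]^{\min\{1,\binom r2\}}}$$ and $$\sum_{k=0}^{n_1}(-1)^k q^{\binom k2+j(k^2+k)-rk}[2k+1][k]^r[k+1]^r\prod_{i=1}^m {n_i+n_{i+1}+1\brack n_i-k}\equiv 0 \pmod{[n_1+n_m+1]{n_1+n_m\brack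 n_1}[n_1]^{\min\{1,r\}}[n_m]^{\min\{1,r\}}}.$$ -/

import Mathlib

open Polynomial
open scoped LaurentPolynomial

/-- The `q`-integer `[n] = 1 + q + ⋯ + q^(n-1)`, a polynomial in the variable `q = X`. -/
noncomputable def qInt (n : ℕ) : ℤ[X] := ∑ i ∈ Finset.range n, X ^ i

/-- The `q`-binomial coefficient with natural lower index, as an element of `ℤ[q]`,
built by the `q`-Pascal rule; the product formula is `algebraMap_qBinom` below. -/
noncomputable def qBinomNat : ℕ → ℕ → ℤ[X]
  | _, 0 => 1
  | 0, _ + 1 => 0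
  | n + 1, k + 1 => qBinomNat n k + X ^ (k + 1) * qBinomNat n (k + 1)

/-- The `q`-binomial coefficient `[n brack k]` with integer lower index:
it is zero when `k < 0`. -/
noncomputable def qBinom (n : ℕ) (k : ℤ) : ℤ[X] :=
  if 0 ≤ k then qBinomNat n k.toNat else 0

/-- The variable `q` in the field of fractions of `ℤ[q]`. -/
noncomputable def qVar : FractionRing ℤ[X] := algebraMap ℤ[X] (FractionRing ℤ[X]) X

theorem qVar_ne_zero : qVar ≠ 0 := by
  unfold qVar
  simpa using (X_ne_zero : (X : ℤ[X]) ≠ 0)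

theorem one_sub_qVar_pow_ne_zero (i : ℕ) : 1 - qVar ^ (i + 1) ≠ 0 := by
  intro h
  have h2 : algebraMap ℤ[X] (FractionRing ℤ[X]) (1 - X ^ (i + 1)) =
      algebraMap ℤ[X] (FractionRing ℤ[X]) 0 := by
    simpa [qVar] using h
  have h3 := IsFractionRing.injective ℤ[X] (FractionRing ℤ[X]) h2
  have h4 := congrArg (Polynomial.eval 0) h3
  simp at h4

theorem algebraMap_qBinomNat_mul (n : ℕ) : ∀ k : ℕ,
    algebraMap ℤ[X] (FractionRing ℤ[X]) (qBinomNat n k) *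
        ∏ i ∈ Finset.range k, (1 - qVar ^ (i + 1)) =
      ∏ i ∈ Finset.range k, (1 - qVar ^ ((n : ℤ) - i)) := by
  induction n with
  | zero =>
    intro k
    cases k with
    | zero => simp [qBinomNat]
    | succ k => rw [Finset.prod_range_succ' (fun i : ℕ => 1 - qVar ^ (((0 : ℕ) : ℤ) - i))]
                simp [qBinomNat]
  | succ n ih =>
    intro k
    cases k with
    | zero => simp [qBinomNat]
    | succ k =>
      have h1 := ih k
      have h2 := ih (k + 1)
      rw [Finset.prod_range_succ, Finset.prod_range_succ] at h2
      have e1 : qVar ^ (k + 1) * qVar ^ ((n : ℤ) - k) = qVar ^ ((n : ℤ) + 1) := by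
        rw [← zpow_natCast, ← zpow_add₀ qVar_ne_zero]
        congr 1
        push_cast
        ring
      rw [Finset.prod_range_succ' (fun i : ℕ => 1 - qVar ^ (((n + 1 : ℕ) : ℤ) - i)),
        Finset.prod_range_succ]
      have e2 : ∏ i ∈ Finset.range k, (1 - qVar ^ (((n + 1 : ℕ) : ℤ) - ((i + 1 : ℕ) : ℤ))) =
          ∏ i ∈ Finset.range k, (1 - qVar ^ ((n : ℤ) - i)) := by
        refine Finset.prod_congr rfl fun i _ => ?_
        congr 2
        push_cast
        ring
      have e3 : (((n + 1 : ℕ) : ℤ) - ((0 : ℕ) : ℤ)) = (n : ℤ) + 1 := by simp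
      rw [e2, e3, ← e1, qBinomNat, map_add, map_mul, map_pow]
      change (_ + qVar ^ (k + 1) * _) * _ = _
      linear_combination (1 - qVar ^ (k + 1)) * h1 + qVar ^ (k + 1) * h2

/-- The defining product formula: for `k ≥ 0` the `q`-binomial coefficient `[n brack k]` is
`∏_{i=1}^k (1 - q^(n-i+1)) / (1 - q^i)`, and it is `0` for `k < 0`. -/
theorem algebraMap_qBinom (n : ℕ) (k : ℤ) :
    algebraMap ℤ[X] (FractionRing ℤ[X]) (qBinom n k) =
      if 0 ≤ k then
        ∏ i ∈ Finset.Icc 1 k.toNat, (1 - qVar ^ ((n : ℤ) - i + 1)) / (1 - qVar ^ i)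
      else 0 := by
  unfold qBinom
  split_ifs with h
  · rw [Finset.prod_div_distrib, eq_div_iff]
    · have h1 := algebraMap_qBinomNat_mul n k.toNat
      rw [Finset.range_eq_Ico, Finset.prod_Ico_add' (fun i : ℕ => 1 - qVar ^ i) 0 k.toNat 1] at h1
      have h2 : ∏ i ∈ Finset.Ico 0 k.toNat, (1 - qVar ^ ((n : ℤ) - i)) =
          ∏ i ∈ Finset.Ico (0 + 1) (k.toNat + 1), (1 - qVar ^ ((n : ℤ) - i + 1)) := by
        rw [← Finset.prod_Ico_add' (fun i : ℕ => 1 - qVar ^ ((n : ℤ) - i + 1)) 0 k.toNat 1]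
        refine Finset.prod_congr rfl fun i _ => ?_
        congr 2
        push_cast
        ring
      rw [h2] at h1
      exact h1
    · refine Finset.prod_ne_zero_iff.mpr fun i hi => ?_
      obtain ⟨i, rfl⟩ := Nat.exists_eq_add_of_le' (Finset.mem_Icc.mp hi).1
      exact one_sub_qVar_pow_ne_zero i
  · simp

/-- Congruence of Laurent polynomials `A ≡ B mod D` for a polynomial `D` in `q`:
`(A - B) / D` is again a Laurent polynomial, here with integer coefficients. -/
def LaurentModEq (D : ℤ[X]) (A B : ℤ[T;T⁻¹]) : Prop := toLaurent D ∣ A - B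

/-! Write `B(n,k) = 1/([n-k]! [n+k+1]!)`. Expanding the binomials into factorials and regrouping
cyclically, their product becomes the factorials `[n_i+n_{i+1}+1]!` times `∏ B(n_i,k)`. The closing
factor `[n_1+n_m+1]!` supplies `[n_1+n_m+1]` and the binomial of the modulus, leaving `[n_1]!
[n_m]!`; what remains is `chainSum` (`prod_intEvalAt_qBinom`).

The chain is shortened by linearising products of kernels: `[x+y+1]! B(x,k) B(y,k)` is a combination
of the `B(t,k)`, by a `q`-Vandermonde convolution. The dual convolution does the same while
absorbing one factor `q^(k(k+1))`. So the `m-1` merges absorb up to `m-1` such factors and a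
limiting identity for a single kernel absorbs one more, whence `j ≤ m`. The coefficients are
polynomials in `q` times `q`-binomials (`chainSum_cons`, `kernelSum_mul_pow`).

This leaves the one-kernel sums `kernelSum`. For `r = 0` they telescope, to `q^(-n)` in the first
case and to `0` for `n ≥ 1` in the alternating case. Raising `r` by one follows `q^n S_{r+1}(n) =
[n][n+1] S_r(n) - [n]^2 S_r(n-1)`: the first step yields a factor `[n]` and the second a factor
`[n]^2`, while in the alternating case `[n]^2` appears at once. This is the source of the different
exponents.

Finally `[t]` times the binomial `t` out of `x` is a multiple of `[x]`, so in each merge the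
binomials carry the factors `[t]` back to `[n_1]` and `[n_m]` (`isMultipleIn_chainSum`). Everything
is computed in a fraction field, with cofactors kept in a subring. -/

/-! ### `q`-factorials, `q`-binomials and Vandermonde convolutions over a field. -/

section QAnalogues

variable {K : Type*} [Field K]

/-- The `q`-integer `[n]` evaluated at an element `q` of a field. -/
def qIntAt (q : K) (n : ℕ) : K := ∑ i ∈ Finset.range n, q ^ i

/-- The `q`-factorial evaluated at an element `q` of a field. -/
def qFactAt (q : K) (n : ℕ) : K := ∏ i ∈ Finset.range n, qIntAt q (i + 1)

/-- The evaluation of integer polynomials at an element `q` of a field. -/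
noncomputable def intEvalAt (q : K) : ℤ[X] →+* K := eval₂RingHom (Int.castRingHom K) q

@[simp] theorem intEvalAt_X (q : K) : intEvalAt q X = q := by simp [intEvalAt]

/-- The `q`-binomial coefficient evaluated at an element `q` of a field. -/
noncomputable def qBinomAt (q : K) (n k : ℕ) : K := intEvalAt q (qBinomNat n k)

/-- The reciprocal of the `q`-factorial of `n - k`, vanishing for `k > n`. -/
noncomputable def invFactSub (q : K) (n k : ℕ) : K := if k ≤ n then (qFactAt q (n - k))⁻¹ else 0

/-- The kernel `1 / ([n - k]! [n + k + 1]!)`, vanishing for `k > n`. -/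
noncomputable def baileyKernel (q : K) (n k : ℕ) : K :=
  invFactSub q n k * (qFactAt q (n + k + 1))⁻¹

@[simp] theorem qIntAt_zero (q : K) : qIntAt q 0 = 0 := by simp [qIntAt]

@[simp] theorem qIntAt_one (q : K) : qIntAt q 1 = 1 := by simp [qIntAt]

theorem qIntAt_add (q : K) (a b : ℕ) : qIntAt q (a + b) = qIntAt q a + q ^ a * qIntAt q b := by
  simp [qIntAt, Finset.sum_range_add, pow_add, Finset.mul_sum]

theorem qIntAt_succ (q : K) (a : ℕ) : qIntAt q (a + 1) = qIntAt q a + q ^ a := by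
  simp [qIntAt_add]

theorem pow_eq_qIntAt (q : K) (k : ℕ) : q ^ k = 1 - (1 - q) * qIntAt q k := by
  induction k with
  | zero => simp
  | succ k ih => rw [pow_succ, qIntAt_succ, ih]; ring

@[simp] theorem qFactAt_zero (q : K) : qFactAt q 0 = 1 := by simp [qFactAt]

theorem qFactAt_succ (q : K) (n : ℕ) : qFactAt q (n + 1) = qFactAt q n * qIntAt q (n + 1) := by
  simp [qFactAt, Finset.prod_range_succ]

theorem qFactAt_ne_zero {q : K} (hq : ∀ n, qIntAt q (n + 1) ≠ 0) (n : ℕ) : qFactAt q n ≠ 0 :=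
  Finset.prod_ne_zero_iff.mpr fun i _ => hq i

@[simp] theorem qBinomAt_zero_right (q : K) (n : ℕ) : qBinomAt q n 0 = 1 := by
  cases n <;> simp [qBinomAt, qBinomNat]

@[simp] theorem qBinomAt_zero_succ (q : K) (k : ℕ) : qBinomAt q 0 (k + 1) = 0 := by
  simp [qBinomAt, qBinomNat]

theorem qBinomAt_succ_succ (q : K) (n k : ℕ) :
    qBinomAt q (n + 1) (k + 1) = qBinomAt q n k + q ^ (k + 1) * qBinomAt q n (k + 1) := by
  simp [qBinomAt, qBinomNat]

theorem qBinomAt_of_lt (q : K) : ∀ {n k : ℕ}, n < k → qBinomAt q n k = 0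
  | 0, k + 1, _ => by simp
  | n + 1, k + 1, h => by
    rw [qBinomAt_succ_succ, qBinomAt_of_lt q (by lia), qBinomAt_of_lt q (by lia)]
    simp

@[simp] theorem qBinomAt_self (q : K) (n : ℕ) : qBinomAt q n n = 1 := by
  induction n with
  | zero => simp
  | succ n ih => rw [qBinomAt_succ_succ, ih, qBinomAt_of_lt q (by lia)]; simp

theorem qBinomAt_mul_qFactAt (q : K) (n : ℕ) : ∀ a b : ℕ, a + b = n →
    qBinomAt q n a * (qFactAt q a * qFactAt q b) = qFactAt q n := by
  induction n with
  | zero =>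
    intro a b h
    obtain ⟨rfl, rfl⟩ : a = 0 ∧ b = 0 := by lia
    simp
  | succ n ih =>
    intro a b h
    rcases a with _ | a
    · obtain rfl : b = n + 1 := by lia
      simp
    rcases b with _ | b
    · obtain rfl : a = n := by lia
      simp
    have h1 := ih a (b + 1) (by lia)
    have h2 := ih (a + 1) b (by lia)
    have h3 : qIntAt q (n + 1) = qIntAt q (a + 1) + q ^ (a + 1) * qIntAt q (b + 1) := by
      rw [← qIntAt_add]; congr 1; lia
    rw [qBinomAt_succ_succ, qFactAt_succ q n, h3]
    rw [qFactAt_succ] at h1 h2 ⊢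
    rw [qFactAt_succ q b]
    linear_combination qIntAt q (a + 1) * h1 + q ^ (a + 1) * qIntAt q (b + 1) * h2

theorem qBinomAt_eq_mul_inv {q : K} (hq : ∀ n, qIntAt q (n + 1) ≠ 0) (n a b : ℕ) (h : a + b = n) :
    qBinomAt q n a = qFactAt q n * (qFactAt q a)⁻¹ * (qFactAt q b)⁻¹ := by
  have := qFactAt_ne_zero hq a
  have := qFactAt_ne_zero hq b
  rw [← qBinomAt_mul_qFactAt q n a b h]
  field_simp

/-- The second `q`-Pascal rule. -/
theorem qBinomAt_succ_succ' (q : K) (n k d : ℕ) (h : k + d = n) :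
    qBinomAt q (n + 1) (k + 1) = q ^ d * qBinomAt q n k + qBinomAt q n (k + 1) := by
  induction n generalizing k d with
  | zero =>
    obtain ⟨rfl, rfl⟩ : k = 0 ∧ d = 0 := by lia
    simp
  | succ n ih =>
    rcases d with _ | d
    · obtain rfl : k = n + 1 := by lia
      rw [qBinomAt_of_lt q (Nat.lt_succ_self (n + 1))]
      simp
    rcases k with _ | k
    · obtain rfl : d = n := by lia
      have := ih 0 d (by lia)
      rw [qBinomAt_succ_succ, this]
      have h4 := qBinomAt_succ_succ q d 0
      simp only [zero_add, qBinomAt_zero_right] at *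
      linear_combination this - h4
    · have h1 := ih k (d + 1) (by lia)
      have h2 := ih (k + 1) d (by lia)
      have h3 := qBinomAt_succ_succ q n k
      have h4 := qBinomAt_succ_succ q n (k + 1)
      rw [qBinomAt_succ_succ q (n + 1), h3, h4]
      rw [h3] at h1
      rw [h4] at h2
      linear_combination h1 + q ^ (k + 2) * h2

theorem qBinomAt_succ_mul_qIntAt {q : K} (hq : ∀ n, qIntAt q (n + 1) ≠ 0) (n k : ℕ) :
    qBinomAt q (n + 1) (k + 1) * qIntAt q (k + 1) = qIntAt q (n + 1) * qBinomAt q n k := by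
  rcases le_or_gt k n with h | h
  · obtain ⟨d, rfl⟩ := Nat.exists_eq_add_of_le h
    have h1 := qBinomAt_mul_qFactAt q (k + d + 1) (k + 1) d (by lia)
    have h2 := qBinomAt_mul_qFactAt q (k + d) k d rfl
    rw [qFactAt_succ, qFactAt_succ] at h1
    apply mul_right_cancel₀ (mul_ne_zero (qFactAt_ne_zero hq k) (qFactAt_ne_zero hq d))
    linear_combination h1 - qIntAt q (k + d + 1) * h2
  · rw [qBinomAt_of_lt q h, qBinomAt_of_lt q (by lia)]; simp

theorem invFactSub_succ_right {q : K} (hq : ∀ n, qIntAt q (n + 1) ≠ 0) {n k : ℕ} (h : k ≤ n) :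
    invFactSub q n (k + 1) = qIntAt q (n - k) * invFactSub q n k := by
  obtain ⟨d, rfl⟩ := Nat.exists_eq_add_of_le h
  rcases d with _ | d
  · simp [invFactSub]
  · have e1 : k + (d + 1) - (k + 1) = d := by lia
    have := qFactAt_ne_zero hq d
    simp only [invFactSub, if_pos h, if_pos (show k + 1 ≤ k + (d + 1) by lia), e1,
      Nat.add_sub_cancel_left, qFactAt_succ]
    field_simp [hq d]

theorem invFactSub_succ_left {q : K} (hq : ∀ n, qIntAt q (n + 1) ≠ 0) {n k : ℕ} (h : k ≤ n + 1) :
    invFactSub q n k = qIntAt q (n + 1 - k) * invFactSub q (n + 1) k := by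
  rcases h.eq_or_lt with rfl | h'
  · simp [invFactSub]
  · obtain ⟨d, rfl⟩ := Nat.exists_eq_add_of_le (Nat.lt_succ_iff.mp h')
    have e1 : k + d + 1 - k = d + 1 := by lia
    have := qFactAt_ne_zero hq d
    simp only [invFactSub, if_pos h, if_pos (show k ≤ k + d by lia), e1,
      Nat.add_sub_cancel_left, qFactAt_succ]
    field_simp [hq d]

theorem invFactSub_of_lt (q : K) {n k : ℕ} (h : n < k) : invFactSub q n k = 0 :=
  if_neg (by lia)

theorem baileyKernel_of_lt (q : K) {n k : ℕ} (h : n < k) : baileyKernel q n k = 0 := by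
  simp [baileyKernel, invFactSub_of_lt q h]

/-- Turns the factorial quotients arising from a merge into integral binomials; the shift `c`
accounts for the next entry of the chain. -/
theorem qFactAt_mul_invFactSub {q : K} (hq : ∀ n, qIntAt q (n + 1) ≠ 0) (y t c : ℕ) :
    qFactAt q (y + c) * invFactSub q y t = qBinomAt q (y + c) (t + c) * qFactAt q (t + c) := by
  rcases le_or_gt t y with h | h
  · obtain ⟨d, rfl⟩ := Nat.exists_eq_add_of_le h
    have h1 := qBinomAt_mul_qFactAt q (t + d + c) (t + c) d (by lia)
    simp only [invFactSub, if_pos h, Nat.add_sub_cancel_left]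
    rw [← h1]
    field_simp [qFactAt_ne_zero hq d]
  · rw [invFactSub_of_lt q h, qBinomAt_of_lt q (by lia)]; simp

/-- The `q`-Vandermonde convolution. -/
theorem sum_qBinomAt_mul_qBinomAt (q : K) (B : ℕ) : ∀ A r : ℕ,
    ∑ s ∈ Finset.range (r + 1), q ^ ((A - s) * (r - s)) * qBinomAt q A s * qBinomAt q B (r - s) =
      qBinomAt q (A + B) r := by
  intro A
  induction A with
  | zero =>
    intro r
    rw [Finset.sum_range_succ']
    simp
  | succ A ih =>
    intro r
    rcases r with _ | r
    · simp
    have e : A + 1 + B = A + B + 1 := by lia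
    -- Pascal's rule on the right; after splitting off `s = 0`, Pascal's rule for `A + 1` matches
    -- the remaining terms one by one.
    rw [e, qBinomAt_succ_succ, ← ih r, ← ih (r + 1), Finset.sum_range_succ',
      Finset.sum_range_succ' _ (r + 1), mul_add, ← add_assoc, Finset.mul_sum,
      ← Finset.sum_add_distrib]
    congr 1
    · refine Finset.sum_congr rfl fun s _ => ?_
      have e2 : r + 1 - (s + 1) = r - s := by lia
      have e3 : A + 1 - (s + 1) = A - s := by lia
      rw [qBinomAt_succ_succ, e2, e3]
      rcases le_or_gt (s + 1) A with h | h
      · rcases le_or_gt s r with h' | h'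
        · have e4 : (A - s) * (r - s) + (s + 1) = (r + 1) + (A - (s + 1)) * (r - s) := by
            obtain ⟨d, rfl⟩ := Nat.exists_eq_add_of_le h
            obtain ⟨e, rfl⟩ := Nat.exists_eq_add_of_le h'
            have : s + 1 + d - s = d + 1 := by lia
            simp only [this, Nat.add_sub_cancel_left]
            ring
          have e5 : q ^ ((A - s) * (r - s)) * q ^ (s + 1) =
              q ^ (r + 1) * q ^ ((A - (s + 1)) * (r - s)) := by
            rw [← pow_add, ← pow_add, e4]
          linear_combination qBinomAt q A (s + 1) * qBinomAt q B (r - s) * e5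
        · simp_all
          lia
      · rw [qBinomAt_of_lt q h]; ring
    · simp only [Nat.sub_zero, qBinomAt_zero_right, ← mul_assoc, ← pow_add]
      congr 3
      ring

/-- The `q`-Vandermonde convolution with the dual choice of powers of `q`. -/
theorem sum_qBinomAt_mul_qBinomAt' (q : K) : ∀ N M c : ℕ,
    ∑ s ∈ Finset.range (M + 1), q ^ (s * (s + c)) * qBinomAt q N s * qBinomAt q (M + c) (M - s) =
      qBinomAt q (N + (M + c)) M := by
  intro N
  induction N with
  | zero =>
    intro M c
    rw [Finset.sum_range_succ']
    simp
  | succ N ih =>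
    intro M c
    rcases M with _ | M
    · simp
    have e : N + 1 + (M + 1 + c) = N + (M + 1 + c) + 1 := by lia
    have e' : N + (M + 1 + c) = N + (M + (c + 1)) := by lia
    -- The second Pascal rule is needed here: lowering `M` while raising `c` keeps `M + c` fixed.
    rw [e, qBinomAt_succ_succ' q _ M (N + c + 1) (by lia), ← ih (M + 1) c, e', ← ih M (c + 1),
      Finset.sum_range_succ', Finset.sum_range_succ' _ (M + 1), ← add_assoc, Finset.mul_sum,
      ← Finset.sum_add_distrib]
    congr 1
    · refine Finset.sum_congr rfl fun s _ => ?_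
      have e2 : M + 1 - (s + 1) = M - s := by lia
      have e6 : M + (c + 1) = M + 1 + c := by lia
      rw [e2, e6]
      rcases le_or_gt s N with h | h
      · obtain ⟨d, rfl⟩ := Nat.exists_eq_add_of_le h
        rw [qBinomAt_succ_succ' q _ s d rfl]
        have e5 : q ^ ((s + 1) * (s + 1 + c)) * q ^ d =
            q ^ (s + d + c + 1) * q ^ (s * (s + (c + 1))) := by
          rw [← pow_add, ← pow_add]
          congr 1
          ring
        linear_combination qBinomAt q (s + d) s * qBinomAt q (M + 1 + c) (M - s) * e5
      · rw [qBinomAt_of_lt q h, qBinomAt_of_lt q (show N < s + 1 by lia),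
          qBinomAt_of_lt q (show N + 1 < s + 1 by lia)]
        ring
    · simp

/-- The limiting case of the `q`-Vandermonde convolution for an infinite upper index. -/
theorem sum_qBinomAt_mul_invFactAt {q : K} (hq : ∀ n, qIntAt q (n + 1) ≠ 0) : ∀ N c : ℕ,
    ∑ s ∈ Finset.range (N + 1), q ^ (s * (s + c)) * qBinomAt q N s * (1 - q) ^ (N - s) *
      (qFactAt q (s + c))⁻¹ = (qFactAt q (N + c))⁻¹ := by
  intro N
  induction N with
  | zero => simp
  | succ N ih =>
    intro c
    have e : N + 1 + c = N + (c + 1) := by lia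
    rw [e, ← ih (c + 1), Finset.sum_range_succ']
    have h1 : ∀ s ∈ Finset.range (N + 1),
        q ^ ((s + 1) * (s + 1 + c)) * qBinomAt q (N + 1) (s + 1) * (1 - q) ^ (N + 1 - (s + 1)) *
          (qFactAt q (s + 1 + c))⁻¹ =
        q ^ ((s + 1) * (s + 1 + c)) * qBinomAt q N s * (1 - q) ^ (N - s) *
          (qFactAt q (s + 1 + c))⁻¹ +
        q ^ ((s + 1) * (s + 1 + (c + 1))) * qBinomAt q N (s + 1) * (1 - q) ^ (N - s) *
          (qFactAt q (s + 1 + c))⁻¹ := by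
      intro s _
      rw [qBinomAt_succ_succ, Nat.add_sub_add_right]
      have e5 : q ^ ((s + 1) * (s + 1 + c)) * q ^ (s + 1) = q ^ ((s + 1) * (s + 1 + (c + 1))) := by
        rw [← pow_add, ← mul_add_one, add_assoc (s + 1) c 1]
      linear_combination qBinomAt q N (s + 1) * (1 - q) ^ (N - s) * (qFactAt q (s + 1 + c))⁻¹ * e5
    rw [Finset.sum_congr rfl h1, Finset.sum_add_distrib, add_assoc]
    have h2 : ∑ s ∈ Finset.range (N + 1),
          q ^ ((s + 1) * (s + 1 + (c + 1))) * qBinomAt q N (s + 1) * (1 - q) ^ (N - s) *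
            (qFactAt q (s + 1 + c))⁻¹ +
          q ^ (0 * (0 + c)) * qBinomAt q (N + 1) 0 * (1 - q) ^ (N + 1 - 0) *
            (qFactAt q (0 + c))⁻¹ =
        ∑ s ∈ Finset.range (N + 1), q ^ (s * (s + (c + 1))) * qBinomAt q N s *
          (1 - q) ^ (N + 1 - s) * (qFactAt q (s + c))⁻¹ := by
      rw [Finset.sum_range_succ, Finset.sum_range_succ' _ N,
        qBinomAt_of_lt q (Nat.lt_succ_self N)]
      simp
    rw [h2, ← Finset.sum_add_distrib]
    refine Finset.sum_congr rfl fun s hs => ?_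
    obtain ⟨d, rfl⟩ := Nat.exists_eq_add_of_le (Nat.lt_succ_iff.mp (Finset.mem_range.mp hs))
    have e1 : s + d + 1 - s = d + 1 := by lia
    have e2 : s + 1 + c = s + c + 1 := by lia
    have e3 : s + (c + 1) = s + c + 1 := by lia
    have e4 : (s + 1) * (s + c + 1) = s * (s + c + 1) + (s + c + 1) := by ring
    -- Each pair of terms combines through `q^(s+c+1) + (1-q)[s+c+1] = 1`.
    rw [e1, e2, e3, e4, Nat.add_sub_cancel_left, qFactAt_succ, pow_add q, pow_eq_qIntAt q (s + c + 1)]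
    have := hq (s + c)
    have := qFactAt_ne_zero hq (s + c)
    field_simp
    ring

end QAnalogues

/-! ### Linearisation of products of kernels. -/

section Kernel

variable {K : Type*} [Field K] {q : K}

/-- Terms with `t < k` vanish; putting `t = k + s` exposes a convolution with offset `2k+1`. -/
theorem sum_invFactSub_mul_baileyKernel_eq_shift (x k : ℕ) (f : ℕ → K) :
    ∑ t ∈ Finset.range (x + 1), f t * invFactSub q x t * baileyKernel q t k =
      if k ≤ x then ∑ s ∈ Finset.range (x - k + 1), f (k + s) * (qFactAt q (x - k - s))⁻¹ *
        ((qFactAt q s)⁻¹ * (qFactAt q (s + (2 * k + 1)))⁻¹) else 0 := by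
  split_ifs with h
  · obtain ⟨N, rfl⟩ := Nat.exists_eq_add_of_le h
    rw [add_assoc k N 1, Finset.sum_range_add, Finset.sum_eq_zero, zero_add,
      Nat.add_sub_cancel_left]
    · refine Finset.sum_congr rfl fun s hs => ?_
      have hs' := Finset.mem_range.mp hs
      have e1 : k + N - (k + s) = N - s := by lia
      have e2 : k + s + k + 1 = s + (2 * k + 1) := by lia
      simp only [baileyKernel, invFactSub, if_pos (show k + s ≤ k + N by lia), e1, e2,
        if_pos (Nat.le_add_right k s), Nat.add_sub_cancel_left]
    · intro t ht
      rw [baileyKernel_of_lt q (Finset.mem_range.mp ht), mul_zero]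
  · refine Finset.sum_eq_zero fun t ht => ?_
    rw [baileyKernel_of_lt q (by have := Finset.mem_range.mp ht; lia), mul_zero]

/-- With `N = x - k` and `M = y - k`, clearing factorials turns the linearisation into a
Vandermonde-type identity. The weights `e` and `ω` are left free so that both convolutions can be
used. -/
theorem baileyKernel_mul_baileyKernel_aux (hq : ∀ n, qIntAt q (n + 1) ≠ 0) (x y k : ℕ)
    (e : ℕ → K) (ω : K)
    (h : ∀ N M, k + N = x → k + M = y →
      ∑ s ∈ Finset.range (M + 1), e (k + s) * qBinomAt q N s *
        qBinomAt q (M + (2 * k + 1)) (M - s) = ω * qBinomAt q (N + (M + (2 * k + 1))) M) :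
    ω * (qFactAt q (x + (y + 1)) * baileyKernel q x k * baileyKernel q y k) =
      ∑ t ∈ Finset.range (x + 1),
        (e t * invFactSub q y t) * invFactSub q x t * baileyKernel q t k := by
  rw [sum_invFactSub_mul_baileyKernel_eq_shift]
  split_ifs with hx
  swap
  · rw [baileyKernel_of_lt q (show x < k by lia)]; simp
  rcases lt_or_ge y k with hy | hy
  · rw [baileyKernel_of_lt q hy, Finset.sum_eq_zero]
    · simp
    · intro s _
      rw [invFactSub_of_lt q (show y < k + s by lia)]; simp
  obtain ⟨N, rfl⟩ := Nat.exists_eq_add_of_le hx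
  obtain ⟨M, rfl⟩ := Nat.exists_eq_add_of_le hy
  have h0 := h N M rfl rfl
  have F := qFactAt_ne_zero hq
  have hN := qBinomAt_mul_qFactAt q (N + (M + (2 * k + 1))) M (N + (2 * k + 1)) (by lia)
  have e1 : k + N + (k + M + 1) = N + (M + (2 * k + 1)) := by lia
  have e2 : k + N + k + 1 = N + (2 * k + 1) := by lia
  have e3 : k + M + k + 1 = M + (2 * k + 1) := by lia
  simp only [baileyKernel, invFactSub, if_pos hx, if_pos hy, Nat.add_sub_cancel_left, e1, e2, e3]
  have e4 : ω * (qFactAt q (N + (M + (2 * k + 1))) *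
      ((qFactAt q N)⁻¹ * (qFactAt q (N + (2 * k + 1)))⁻¹) *
      ((qFactAt q M)⁻¹ * (qFactAt q (M + (2 * k + 1)))⁻¹)) =
      (ω * qBinomAt q (N + (M + (2 * k + 1))) M) *
        ((qFactAt q N)⁻¹ * (qFactAt q (M + (2 * k + 1)))⁻¹) := by
    rw [← hN]
    field_simp [F M, F (N + (2 * k + 1))]
  rw [e4, ← h0, Finset.sum_mul]
  have key : ∀ s, s ≤ N → s ≤ M → e (k + s) * qBinomAt q N s *
        qBinomAt q (M + (2 * k + 1)) (M - s) *
        ((qFactAt q N)⁻¹ * (qFactAt q (M + (2 * k + 1)))⁻¹) =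
      e (k + s) * (if k + s ≤ k + M then (qFactAt q (k + M - (k + s)))⁻¹ else 0) *
        (qFactAt q (N - s))⁻¹ * ((qFactAt q s)⁻¹ * (qFactAt q (s + (2 * k + 1)))⁻¹) := by
    intro s h1 h2
    have b1 := qBinomAt_eq_mul_inv hq N s (N - s) (by lia)
    have b2 := qBinomAt_eq_mul_inv hq (M + (2 * k + 1)) (M - s) (s + (2 * k + 1)) (by lia)
    have e5 : k + M - (k + s) = M - s := by lia
    rw [if_pos (by lia), e5, b1, b2]
    have n1 := mul_inv_cancel₀ (F N)
    have n2 := mul_inv_cancel₀ (F (M + (2 * k + 1)))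
    calc _ = e (k + s) * (qFactAt q s)⁻¹ * (qFactAt q (N - s))⁻¹ * (qFactAt q (M - s))⁻¹ *
          (qFactAt q (s + (2 * k + 1)))⁻¹ * (qFactAt q N * (qFactAt q N)⁻¹) *
          (qFactAt q (M + (2 * k + 1)) * (qFactAt q (M + (2 * k + 1)))⁻¹) := by ring
      _ = _ := by rw [n1, n2]; ring
  -- The two sums have different ranges, but their terms vanish beyond `min N M`.
  have l1 : ∀ s ∈ Finset.range (M + 1), s ∉ Finset.range (min N M + 1) →
      e (k + s) * qBinomAt q N s * qBinomAt q (M + (2 * k + 1)) (M - s) *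
        ((qFactAt q N)⁻¹ * (qFactAt q (M + (2 * k + 1)))⁻¹) = 0 := by
    intro s h1 h2
    simp only [Finset.mem_range] at h1 h2
    rw [qBinomAt_of_lt q (show N < s by lia)]; ring
  have l2 : ∀ s ∈ Finset.range (N + 1), s ∉ Finset.range (min N M + 1) →
      e (k + s) * (if k + s ≤ k + M then (qFactAt q (k + M - (k + s)))⁻¹ else 0) *
        (qFactAt q (N - s))⁻¹ * ((qFactAt q s)⁻¹ * (qFactAt q (s + (2 * k + 1)))⁻¹) = 0 := by
    intro s h1 h2
    simp only [Finset.mem_range] at h1 h2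
    rw [if_neg (by lia)]; ring
  rw [← Finset.sum_subset (Finset.range_mono (by lia)) l1,
    ← Finset.sum_subset (Finset.range_mono (by lia)) l2]
  refine Finset.sum_congr rfl fun s hs => ?_
  rw [Finset.mem_range] at hs
  exact key s (by lia) (by lia)

theorem baileyKernel_mul_baileyKernel (hq : ∀ n, qIntAt q (n + 1) ≠ 0) (x y k : ℕ) :
    qFactAt q (x + (y + 1)) * baileyKernel q x k * baileyKernel q y k =
      ∑ t ∈ Finset.range (x + 1), (q ^ ((x - t) * (y - t)) * invFactSub q y t) *
        invFactSub q x t * baileyKernel q t k := by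
  have := baileyKernel_mul_baileyKernel_aux hq x y k (fun t => q ^ ((x - t) * (y - t))) 1 ?_
  · simpa using this
  · rintro N M rfl rfl
    simp only [Nat.add_sub_add_left, one_mul]
    exact sum_qBinomAt_mul_qBinomAt q _ N M

/-- Since `(k+s)(k+s+1) = k(k+1) + s(s+2k+1)`, the dual convolution with `c = 2k+1` leaves exactly
the factor `q^(k(k+1))`. -/
theorem pow_mul_baileyKernel_mul_baileyKernel (hq : ∀ n, qIntAt q (n + 1) ≠ 0) (x y k : ℕ) :
    q ^ (k * (k + 1)) * (qFactAt q (x + (y + 1)) * baileyKernel q x k * baileyKernel q y k) =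
      ∑ t ∈ Finset.range (x + 1), (q ^ (t * (t + 1)) * invFactSub q y t) *
        invFactSub q x t * baileyKernel q t k := by
  refine baileyKernel_mul_baileyKernel_aux hq x y k (fun t => q ^ (t * (t + 1))) _ ?_
  rintro N M rfl rfl
  rw [← sum_qBinomAt_mul_qBinomAt', Finset.mul_sum]
  refine Finset.sum_congr rfl fun s _ => ?_
  rw [← mul_assoc, ← mul_assoc, ← pow_add]
  congr 3
  ring

/-- Formal limit of the previous identity as `y → ∞`; it absorbs a power when no neighbour is left
to merge with. -/
theorem pow_mul_baileyKernel (hq : ∀ n, qIntAt q (n + 1) ≠ 0) (x k : ℕ) :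
    q ^ (k * (k + 1)) * baileyKernel q x k =
      ∑ t ∈ Finset.range (x + 1), (q ^ (t * (t + 1)) * (1 - q) ^ (x - t)) *
        invFactSub q x t * baileyKernel q t k := by
  rw [sum_invFactSub_mul_baileyKernel_eq_shift]
  split_ifs with hx
  swap
  · rw [baileyKernel_of_lt q (show x < k by lia)]; simp
  obtain ⟨N, rfl⟩ := Nat.exists_eq_add_of_le hx
  have F := qFactAt_ne_zero hq
  have e2 : k + N + k + 1 = N + (2 * k + 1) := by lia
  simp only [baileyKernel, invFactSub, if_pos hx, Nat.add_sub_cancel_left, e2]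
  rw [← sum_qBinomAt_mul_invFactAt hq, Finset.mul_sum, Finset.mul_sum]
  refine Finset.sum_congr rfl fun s hs => ?_
  have b1 := qBinomAt_mul_qFactAt q N s (N - s) (by grind)
  have e5 : k + N - (k + s) = N - s := by lia
  have n1 := F N
  have e6 : q ^ ((k + s) * (k + s + 1)) = q ^ (k * (k + 1)) * q ^ (s * (s + (2 * k + 1))) := by
    rw [← pow_add]
    congr 1
    ring
  rw [e5, e6]
  rw [← b1] at n1 ⊢
  have n3 := left_ne_zero_of_mul n1
  field_simp [F s, F (N - s), F (s + (2 * k + 1))]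

end Kernel

/-! ### One-kernel sums: recursion in the exponent and telescoping base cases. -/

section SingleSum

variable {K : Type*} [Field K] {q : K}

/-- The `q`-analogue `q^(-k) [k] [k + 1]` of `k (k + 1)`. -/
noncomputable def qPronic (q : K) (k : ℕ) : K := (q ^ k)⁻¹ * qIntAt q k * qIntAt q (k + 1)

/-- The normalised weighted sum of the kernel over `k`. -/
noncomputable def kernelSum (q : K) (w : ℕ → K) (n : ℕ) : K :=
  qFactAt q n ^ 2 * ∑ k ∈ Finset.range (n + 1), w k * baileyKernel q n k

theorem baileyKernel_succ (hq : ∀ n, qIntAt q (n + 1) ≠ 0) {n k : ℕ} (h : k ≤ n + 1) :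
    baileyKernel q n k =
      qIntAt q (n + 1 - k) * qIntAt q (n + 1 + k + 1) * baileyKernel q (n + 1) k := by
  have e : n + k + 1 = n + 1 + k := by lia
  have := hq (n + 1 + k)
  have := qFactAt_ne_zero hq (n + 1 + k)
  rw [baileyKernel, baileyKernel, invFactSub_succ_left hq h, qFactAt_succ q (n + 1 + k), e]
  field_simp

/-- The `q`-analogue of `k(k+1) = n(n+1) - (n-k)(n+k+1)`; the last product is what lowers the
kernel's index by one. -/
theorem pow_mul_qPronic (hq0 : q ≠ 0) {n k : ℕ} (h : k ≤ n) :
    q ^ n * qPronic q k =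
      qIntAt q n * qIntAt q (n + 1) - qIntAt q (n - k) * qIntAt q (n + k + 1) := by
  obtain ⟨d, rfl⟩ := Nat.exists_eq_add_of_le h
  have e : q ^ (k + d) * qPronic q k = q ^ d * qIntAt q k * qIntAt q (k + 1) := by
    rw [qPronic, pow_add]
    field_simp
  rw [e, Nat.add_sub_cancel_left]
  simp only [qIntAt_succ, qIntAt_add, pow_add, pow_eq_qIntAt q k, pow_eq_qIntAt q d]
  ring

theorem pow_mul_kernelSum_mul_qPronic (hq0 : q ≠ 0) (hq : ∀ n, qIntAt q (n + 1) ≠ 0)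
    (w : ℕ → K) (n : ℕ) :
    q ^ (n + 1) * kernelSum q (fun k => w k * qPronic q k) (n + 1) =
      qIntAt q (n + 1) * (qIntAt q (n + 2) * kernelSum q w (n + 1)) -
        qIntAt q (n + 1) ^ 2 * kernelSum q w n := by
  have h1 : ∑ k ∈ Finset.range (n + 1), w k * baileyKernel q n k =
      ∑ k ∈ Finset.range (n + 1 + 1), w k * baileyKernel q n k := by
    rw [Finset.sum_range_succ _ (n + 1), baileyKernel_of_lt q (Nat.lt_succ_self n)]
    simp
  have h2 : q ^ (n + 1) * ∑ k ∈ Finset.range (n + 1 + 1),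
        w k * qPronic q k * baileyKernel q (n + 1) k =
      qIntAt q (n + 1) * qIntAt q (n + 2) *
        ∑ k ∈ Finset.range (n + 1 + 1), w k * baileyKernel q (n + 1) k -
      ∑ k ∈ Finset.range (n + 1 + 1), w k * baileyKernel q n k := by
    rw [Finset.mul_sum, Finset.mul_sum, ← Finset.sum_sub_distrib]
    refine Finset.sum_congr rfl fun k hk => ?_
    have hk' : k ≤ n + 1 := by grind
    rw [baileyKernel_succ hq hk']
    linear_combination w k * baileyKernel q (n + 1) k * pow_mul_qPronic hq0 hk'
  simp only [kernelSum]
  rw [h1, qFactAt_succ]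
  linear_combination (qFactAt q n * qIntAt q (n + 1)) ^ 2 * h2

theorem kernelSum_mul_qPronic_zero (w : ℕ → K) :
    kernelSum q (fun k => w k * qPronic q k) 0 = 0 := by
  simp [kernelSum, qPronic]

theorem kernelSum_inv_pow (hq0 : q ≠ 0) (hq : ∀ n, qIntAt q (n + 1) ≠ 0) (n : ℕ) :
    kernelSum q (fun k => (q ^ k)⁻¹ * qIntAt q (2 * k + 1)) n = (q ^ n)⁻¹ := by
  have F := qFactAt_ne_zero hq
  -- Telescoping form: only the boundary term `1/[n]!^2` at `k = 0` survives.
  have h : ∀ k ∈ Finset.range (n + 1),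
      q ^ n * ((q ^ k)⁻¹ * qIntAt q (2 * k + 1) * baileyKernel q n k) =
        invFactSub q n k * (qFactAt q (n + k))⁻¹ -
          invFactSub q n (k + 1) * (qFactAt q (n + (k + 1)))⁻¹ := by
    intro k hk
    have hk' : k ≤ n := by grind
    rw [invFactSub_succ_right hq hk', baileyKernel, ← add_assoc, qFactAt_succ]
    obtain ⟨d, rfl⟩ := Nat.exists_eq_add_of_le hk'
    have e2 : q ^ d * qIntAt q (2 * k + 1) = qIntAt q (k + d + k + 1) - qIntAt q d := by
      have : k + d + k + 1 = d + (2 * k + 1) := by lia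
      rw [this, qIntAt_add q d]; ring
    rw [Nat.add_sub_cancel_left]
    have := hq (k + d + k)
    have := F (k + d + k)
    field_simp
    linear_combination invFactSub q (k + d) k * q ^ k * e2
  have hs := Finset.sum_congr rfl h
  rw [Finset.sum_range_sub', invFactSub_of_lt q (Nat.lt_succ_self n), ← Finset.mul_sum] at hs
  simp only [invFactSub, Nat.zero_le, if_true, Nat.sub_zero, add_zero, zero_mul, sub_zero] at hs
  rw [kernelSum]
  apply eq_inv_of_mul_eq_one_left
  rw [mul_assoc, mul_comm (∑ _ ∈ _, _), hs]
  field_simp [F n]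

theorem kernelSum_neg_one_pow (hq : ∀ n, qIntAt q (n + 1) ≠ 0) (n : ℕ) :
    kernelSum q (fun k => (-1) ^ k * q ^ k.choose 2 * qIntAt q (2 * k + 1)) (n + 1) = 0 := by
  have F := qFactAt_ne_zero hq
  -- The sum telescopes after multiplication by `[n+1]`. Both boundary terms vanish, the lower one
  -- because of `[0]`; cancelling `[n+1] ≠ 0` is what excludes index `0`.
  have h : ∀ k ∈ Finset.range (n + 1 + 1),
      qIntAt q (n + 1) * ((-1) ^ k * q ^ k.choose 2 * qIntAt q (2 * k + 1) *
          baileyKernel q (n + 1) k) =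
        (-1) ^ k * q ^ k.choose 2 * qIntAt q k *
            (invFactSub q (n + 1) k * (qFactAt q (n + 1 + k))⁻¹) -
          (-1) ^ (k + 1) * q ^ (k + 1).choose 2 * qIntAt q (k + 1) *
            (invFactSub q (n + 1) (k + 1) * (qFactAt q (n + 1 + (k + 1)))⁻¹) := by
    generalize n + 1 = n
    intro k hk
    have hk' : k ≤ n := by grind
    rw [invFactSub_succ_right hq hk', baileyKernel, ← add_assoc, qFactAt_succ]
    obtain ⟨d, rfl⟩ := Nat.exists_eq_add_of_le hk'
    have e1 : (k + 1).choose 2 = k.choose 2 + k := by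
      rw [Nat.choose_succ_succ' k 1, Nat.choose_one_right, add_comm]
    have e2 : qIntAt q (k + d) * qIntAt q (2 * k + 1) =
        qIntAt q k * qIntAt q (k + d + k + 1) + q ^ k * qIntAt q (k + 1) * qIntAt q d := by
      simp only [qIntAt_succ, qIntAt_add, two_mul, pow_add, pow_eq_qIntAt q k, pow_eq_qIntAt q d]
      ring
    rw [Nat.add_sub_cancel_left, e1, pow_add q]
    have := hq (k + d + k)
    have := F (k + d + k)
    field_simp
    linear_combination (-1) ^ k * q ^ k.choose 2 * invFactSub q (k + d) k * e2
  have hs := Finset.sum_congr rfl h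
  rw [Finset.sum_range_sub', invFactSub_of_lt q (Nat.lt_succ_self (n + 1)),
    ← Finset.mul_sum] at hs
  simp only [qIntAt_zero, mul_zero, zero_mul, sub_zero, mul_eq_zero, hq n, false_or] at hs
  rw [kernelSum, hs, mul_zero]

end SingleSum

/-! ### Powers of `[n]` dividing the one-kernel sums. -/

section Divisibility

variable {K : Type*} [Field K] {q : K} {L : Subring K}

/-- `z` is a multiple of `d` with cofactor in the subring `L`. -/
def IsMultipleIn (L : Subring K) (d z : K) : Prop := ∃ p ∈ L, z = d * p

theorem IsMultipleIn.mul_left {c d z : K} (hc : c ∈ L) (h : IsMultipleIn L d z) :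
    IsMultipleIn L d (c * z) := by
  obtain ⟨p, hp, rfl⟩ := h
  exact ⟨c * p, mul_mem hc hp, by ring⟩

theorem IsMultipleIn.mul {d d' z z' : K} (h : IsMultipleIn L d z) (h' : IsMultipleIn L d' z') :
    IsMultipleIn L (d * d') (z * z') := by
  obtain ⟨p, hp, rfl⟩ := h
  obtain ⟨p', hp', rfl⟩ := h'
  exact ⟨p * p', mul_mem hp hp', by ring⟩

theorem IsMultipleIn.sum {d : K} {s : Finset ℕ} {f : ℕ → K}
    (h : ∀ i ∈ s, IsMultipleIn L d (f i)) : IsMultipleIn L d (∑ i ∈ s, f i) := by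
  choose! p hp hf using h
  exact ⟨∑ i ∈ s, p i, sum_mem hp, by rw [Finset.mul_sum, Finset.sum_congr rfl hf]⟩

theorem isMultipleIn_zero (L : Subring K) (d : K) : IsMultipleIn L d 0 :=
  ⟨0, zero_mem L, by simp⟩

theorem intEvalAt_mem (hqL : q ∈ L) (p : ℤ[X]) : intEvalAt q p ∈ L := by
  rw [intEvalAt, coe_eval₂RingHom, eval₂_eq_sum_range]
  exact sum_mem fun i _ => mul_mem (intCast_mem L _) (pow_mem hqL i)

theorem qIntAt_mem (hqL : q ∈ L) (n : ℕ) : qIntAt q n ∈ L := sum_mem fun i _ => pow_mem hqL i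

theorem qFactAt_mem (hqL : q ∈ L) (n : ℕ) : qFactAt q n ∈ L :=
  prod_mem fun i _ => qIntAt_mem hqL (i + 1)

/-- Absorption: one binomial converts at most one factor `[k]` into `[n]`, hence `a ≤ 1`. -/
theorem isMultipleIn_qBinomAt_mul (hq : ∀ n, qIntAt q (n + 1) ≠ 0) (hqL : q ∈ L) {a : ℕ}
    (ha : a ≤ 1) (n k : ℕ) :
    IsMultipleIn L (qIntAt q n ^ a) (qBinomAt q n k * qIntAt q k ^ a) := by
  obtain rfl | rfl : a = 0 ∨ a = 1 := by lia
  · exact ⟨_, intEvalAt_mem hqL (qBinomNat n k), by simp [qBinomAt]⟩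
  rcases k with _ | k
  · simpa using isMultipleIn_zero L _
  rcases n with _ | n
  · simpa using isMultipleIn_zero L _
  rw [pow_one, pow_one, qBinomAt_succ_mul_qIntAt hq]
  exact ⟨_, intEvalAt_mem hqL (qBinomNat n k), rfl⟩

/-- In the recursion the first term gains a factor `[n]` and the second always carries `[n]^2`, so
the guaranteed exponent rises by one but stops at two. -/
theorem isMultipleIn_kernelSum_mul_qPronic (hq0 : q ≠ 0) (hq : ∀ n, qIntAt q (n + 1) ≠ 0)
    (hqL : q ∈ L) (hqL' : q⁻¹ ∈ L) {i : ℕ} (hi : i ≤ 1) {w : ℕ → K}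
    (hw : ∀ n, kernelSum q w n ∈ L)
    (hw' : ∀ n, IsMultipleIn L (qIntAt q (n + 1) ^ i) (kernelSum q w (n + 1))) (n : ℕ) :
    IsMultipleIn L (qIntAt q n ^ (i + 1)) (kernelSum q (fun k => w k * qPronic q k) n) := by
  rcases n with _ | n
  · rw [kernelSum_mul_qPronic_zero]
    exact isMultipleIn_zero L _
  obtain ⟨p, hp, h⟩ := hw' n
  have e : kernelSum q (fun k => w k * qPronic q k) (n + 1) =
      q⁻¹ ^ (n + 1) * (q ^ (n + 1) * kernelSum q (fun k => w k * qPronic q k) (n + 1)) := by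
    rw [inv_pow, inv_mul_cancel_left₀ (pow_ne_zero _ hq0)]
  rw [e, pow_mul_kernelSum_mul_qPronic hq0 hq, h]
  refine IsMultipleIn.mul_left (pow_mem hqL' _) ?_
  refine ⟨qIntAt q (n + 2) * p - qIntAt q (n + 1) ^ (1 - i) * kernelSum q w n,
    sub_mem (mul_mem (qIntAt_mem hqL _) hp) (mul_mem (pow_mem (qIntAt_mem hqL _) _) (hw n)), ?_⟩
  obtain rfl | rfl : i = 0 ∨ i = 1 := by lia
  · ring
  · simp; ring

theorem isMultipleIn_kernelSum_mul_pow (hq0 : q ≠ 0) (hq : ∀ n, qIntAt q (n + 1) ≠ 0)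
    (hqL : q ∈ L) (hqL' : q⁻¹ ∈ L) {w : ℕ → K} (hw : ∀ n, kernelSum q w n ∈ L) (r : ℕ) (n : ℕ) :
    IsMultipleIn L (qIntAt q n ^ (min 1 r + min 1 (r.choose 2)))
      (kernelSum q (fun k => w k * qPronic q k ^ r) n) := by
  have mem : ∀ {d z : K}, d ∈ L → IsMultipleIn L d z → z ∈ L := by
    rintro d z hd ⟨p, hp, rfl⟩
    exact mul_mem hd hp
  induction r generalizing n with
  | zero => exact ⟨_, hw n, by simp⟩
  | succ r ih =>
    simp only [pow_succ (qPronic q _), ← mul_assoc]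
    have hL : ∀ n, kernelSum q (fun k => w k * qPronic q k ^ r) n ∈ L := fun n =>
      mem (pow_mem (qIntAt_mem hqL n) _) (ih n)
    rcases r with _ | r
    · have := isMultipleIn_kernelSum_mul_qPronic hq0 hq hqL hqL' (i := 0) (by lia) hL
        (fun n => ⟨_, hL (n + 1), by simp⟩) n
      simpa using this
    · have h2 : min 1 (r + 1 + 1) + min 1 ((r + 1 + 1).choose 2) = 1 + 1 := by
        have := Nat.choose_pos (show 2 ≤ r + 1 + 1 by lia)
        lia
      rw [h2]
      refine isMultipleIn_kernelSum_mul_qPronic hq0 hq hqL hqL' le_rfl hL (fun n => ?_) n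
      obtain ⟨p, hp, h⟩ := ih (n + 1)
      refine ⟨qIntAt q (n + 1) ^ (min 1 ((r + 1).choose 2)) * p,
        mul_mem (pow_mem (qIntAt_mem hqL _) _) hp, ?_⟩
      rw [h, pow_add, mul_assoc, Nat.min_eq_left (Nat.le_add_left 1 r)]

theorem isMultipleIn_kernelSum_mul_pow_of_eq_zero (hq0 : q ≠ 0)
    (hq : ∀ n, qIntAt q (n + 1) ≠ 0) (hqL : q ∈ L) (hqL' : q⁻¹ ∈ L) {w : ℕ → K}
    (hw0 : kernelSum q w 0 ∈ L) (hw : ∀ n, kernelSum q w (n + 1) = 0) (r : ℕ) (n : ℕ) :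
    IsMultipleIn L (qIntAt q n ^ (min 1 r + min 1 r))
      (kernelSum q (fun k => w k * qPronic q k ^ r) n) := by
  have hL : ∀ n, kernelSum q w n ∈ L := by
    rintro (_ | n)
    · exact hw0
    · rw [hw]; exact zero_mem L
  rcases r with _ | _ | r
  · exact ⟨_, hL n, by simp⟩
  -- Zero is a multiple of `[n+1]`, so `i = 1` is available already at the first step.
  · have := isMultipleIn_kernelSum_mul_qPronic hq0 hq hqL hqL' (i := 1) (by lia) hL
      (fun n => by rw [hw]; exact isMultipleIn_zero L _) n
    simpa using this
  · have := isMultipleIn_kernelSum_mul_pow hq0 hq hqL hqL' hL (r + 2) n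
    have h2 : min 1 (r + 2) + min 1 ((r + 2).choose 2) = min 1 (r + 2) + min 1 (r + 2) := by
      have := Nat.choose_pos (show 2 ≤ r + 2 by lia)
      lia
    rwa [h2] at this

end Divisibility

/-! ### Merging chains of kernels and transporting divisibility. -/

section Chain

variable {K : Type*} [Field K] {q : K}

/-- One more than the first entry of a list, or `0` for the empty list. -/
def headSucc : List ℕ → ℕ
  | [] => 0
  | x :: _ => x + 1

/-- The product of kernels along a list, weighted by the factorials of consecutive entries. -/
noncomputable def chainProd (q : K) (k : ℕ) : List ℕ → K
  | [] => 1
  | x :: l => baileyKernel q x k * qFactAt q (x + headSucc l) * chainProd q k l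

/-- The normalised weighted sum over `k` of the chain products of `x :: l`. -/
noncomputable def chainSum (q : K) (w : ℕ → K) (x : ℕ) (l : List ℕ) : K :=
  qFactAt q x * ∑ k ∈ Finset.range (x + 1), w k * chainProd q k (x :: l)

theorem chainSum_nil (w : ℕ → K) (x : ℕ) : chainSum q w x [] = kernelSum q w x := by
  simp only [chainSum, kernelSum, chainProd, headSucc, Finset.mul_sum]
  exact Finset.sum_congr rfl fun k _ => by ring_nf

theorem chainSum_eq_sum_range (w : ℕ → K) {x t : ℕ} (h : t ≤ x) (l : List ℕ) :
    chainSum q w t l = qFactAt q t * ∑ k ∈ Finset.range (x + 1), w k * chainProd q k (t :: l) := by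
  rw [chainSum]
  congr 1
  refine Finset.sum_subset (Finset.range_mono (by lia)) fun k _ hk => ?_
  rw [Finset.mem_range] at hk
  rw [chainProd, baileyKernel_of_lt q (by lia)]
  ring

/-- Linearising `B(x,k) B(y,k)` and exchanging the sums replaces the first two entries by a single
`t`. The leftover factorials form two binomials. -/
theorem chainSum_cons (hq : ∀ n, qIntAt q (n + 1) ≠ 0) (w ω e : ℕ → K) (x y : ℕ) (l : List ℕ)
    (h : ∀ k, ω k * (qFactAt q (x + (y + 1)) * baileyKernel q x k * baileyKernel q y k) =
      ∑ t ∈ Finset.range (x + 1),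
        (e t * invFactSub q y t) * invFactSub q x t * baileyKernel q t k) :
    chainSum q (fun k => w k * ω k) x (y :: l) =
      ∑ t ∈ Finset.range (x + 1),
        e t * qBinomAt q x t * qBinomAt q (y + headSucc l) (t + headSucc l) * chainSum q w t l := by
  have h1 : ∀ t ∈ Finset.range (x + 1),
      e t * qBinomAt q x t * qBinomAt q (y + headSucc l) (t + headSucc l) * chainSum q w t l =
      ∑ k ∈ Finset.range (x + 1), qFactAt q x * w k * qFactAt q (y + headSucc l) *
        chainProd q k l * (e t * invFactSub q y t * invFactSub q x t * baileyKernel q t k) := by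
    intro t ht
    rw [chainSum_eq_sum_range w (Nat.lt_succ_iff.mp (Finset.mem_range.mp ht)), Finset.mul_sum,
      Finset.mul_sum]
    refine Finset.sum_congr rfl fun k _ => ?_
    have a1 := qFactAt_mul_invFactSub hq x t 0
    have a2 := qFactAt_mul_invFactSub hq y t (headSucc l)
    simp only [add_zero] at a1
    rw [chainProd]
    linear_combination (-e t * w k * chainProd q k l * baileyKernel q t k) *
      (qFactAt q x * invFactSub q x t * a2 +
        qBinomAt q (y + headSucc l) (t + headSucc l) * qFactAt q (t + headSucc l) * a1)
  rw [Finset.sum_congr rfl h1, Finset.sum_comm, chainSum, Finset.mul_sum]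
  refine Finset.sum_congr rfl fun k _ => ?_
  rw [← Finset.mul_sum, ← h, chainProd, chainProd, headSucc]
  ring

theorem kernelSum_mul_pow (hq : ∀ n, qIntAt q (n + 1) ≠ 0) (w : ℕ → K) (x : ℕ) :
    kernelSum q (fun k => w k * q ^ (k * (k + 1))) x =
      ∑ t ∈ Finset.range (x + 1), q ^ (t * (t + 1)) * (1 - q) ^ (x - t) * qFactAt q (x - t) *
        qBinomAt q x t ^ 2 * kernelSum q w t := by
  have h1 : ∀ t ∈ Finset.range (x + 1),
      q ^ (t * (t + 1)) * (1 - q) ^ (x - t) * qFactAt q (x - t) *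
        qBinomAt q x t ^ 2 * kernelSum q w t =
      ∑ k ∈ Finset.range (x + 1), qFactAt q x ^ 2 * w k *
        (q ^ (t * (t + 1)) * (1 - q) ^ (x - t) * invFactSub q x t * baileyKernel q t k) := by
    intro t ht
    have htx := Nat.lt_succ_iff.mp (Finset.mem_range.mp ht)
    rw [← chainSum_nil, chainSum_eq_sum_range w htx, Finset.mul_sum, Finset.mul_sum]
    refine Finset.sum_congr rfl fun k _ => ?_
    have a1 := qFactAt_mul_invFactSub hq x t 0
    have a2 := qBinomAt_mul_qFactAt q x t (x - t) (by lia)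
    simp only [add_zero] at a1
    simp only [chainProd, headSucc, add_zero]
    linear_combination (q ^ (t * (t + 1)) * (1 - q) ^ (x - t) * w k * baileyKernel q t k) *
      (qBinomAt q x t * qFactAt q t * a2 - qFactAt q x * a1)
  rw [Finset.sum_congr rfl h1, Finset.sum_comm, kernelSum, Finset.mul_sum]
  refine Finset.sum_congr rfl fun k _ => ?_
  rw [← Finset.mul_sum, ← pow_mul_baileyKernel hq]
  ring

/-- Induction on the chain: the binomial of `x` moves `a` factors from `[t]` to `[x]`. The other `b`
factors stay on the last entry, which changes only when the last two entries merge. -/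
theorem isMultipleIn_chainSum {L : Subring K} (hq : ∀ n, qIntAt q (n + 1) ≠ 0) (hqL : q ∈ L)
    {a b : ℕ} (ha : a ≤ 1) (hb : b ≤ 1) {w : ℕ → K}
    (hw : ∀ n, IsMultipleIn L (qIntAt q n ^ (a + b)) (kernelSum q w n)) (l : List ℕ) :
    ∀ x j : ℕ, j ≤ l.length + 1 →
      IsMultipleIn L (qIntAt q x ^ a * qIntAt q (l.getLastD x) ^ b)
        (chainSum q (fun k => w k * q ^ (j * (k * (k + 1)))) x l) := by
  have pow_eq : ∀ j k : ℕ, w k * q ^ ((j + 1) * (k * (k + 1))) =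
      w k * q ^ (j * (k * (k + 1))) * q ^ (k * (k + 1)) := by
    intro j k
    rw [mul_assoc, ← pow_add, add_one_mul]
  induction l with
  | nil =>
    intro x j hj
    rw [chainSum_nil, List.getLastD_nil, ← pow_add]
    obtain rfl | rfl : j = 0 ∨ j = 1 := by simp at hj; lia
    · simpa using hw x
    · simp only [one_mul]
      rw [kernelSum_mul_pow hq]
      refine IsMultipleIn.sum fun t _ => ?_
      -- The squared binomial carries `a` factors and `b` factors separately, one copy for each.
      have h1 := isMultipleIn_qBinomAt_mul hq hqL ha x t
      have h2 := isMultipleIn_qBinomAt_mul hq hqL hb x t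
      obtain ⟨p, hp, h⟩ := hw t
      have c : q ^ (t * (t + 1)) * (1 - q) ^ (x - t) * qFactAt q (x - t) * p ∈ L :=
        mul_mem (mul_mem (mul_mem (pow_mem hqL _) (pow_mem (sub_mem (one_mem L) hqL) _))
          (qFactAt_mem hqL _)) hp
      rw [pow_add]
      convert (h1.mul h2).mul_left c using 1
      rw [h]
      ring
  | cons y l ih =>
    have last : ∀ t x, IsMultipleIn L (qIntAt q ((y :: l).getLastD x) ^ b)
        (qBinomAt q (y + headSucc l) (t + headSucc l) * qIntAt q (l.getLastD t) ^ b) := by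
      intro t x
      rw [List.getLastD_cons]
      -- If `y` is last, the shift is `0` and the second binomial moves `[t]^b` to `[y]^b`;
      -- otherwise the last entry is unaffected by the merge.
      rcases l with _ | ⟨z, l⟩
      · simpa [headSucc] using isMultipleIn_qBinomAt_mul hq hqL hb y t
      · exact ⟨_, intEvalAt_mem hqL _, by rw [List.getLastD_cons, List.getLastD_cons, mul_comm,
          qBinomAt]⟩
    have step : ∀ (x j : ℕ) (ω e : ℕ → K), (∀ t, e t ∈ L) → j ≤ l.length + 1 →
        (∀ k, ω k * (qFactAt q (x + (y + 1)) * baileyKernel q x k * baileyKernel q y k) =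
          ∑ t ∈ Finset.range (x + 1),
            (e t * invFactSub q y t) * invFactSub q x t * baileyKernel q t k) →
        IsMultipleIn L (qIntAt q x ^ a * qIntAt q ((y :: l).getLastD x) ^ b)
          (chainSum q (fun k => w k * q ^ (j * (k * (k + 1))) * ω k) x (y :: l)) := by
      intro x j ω e he hj h
      rw [chainSum_cons hq _ ω e x y l h]
      refine IsMultipleIn.sum fun t _ => ?_
      obtain ⟨p, hp, h⟩ := ih t j hj
      convert ((isMultipleIn_qBinomAt_mul hq hqL ha x t).mul (last t x)).mul_left
        (mul_mem (he t) hp) using 1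
      rw [h]
      ring
    intro x j hj
    -- While powers remain, each merge absorbs one; once `j = 0`, the plain linearisation is used.
    rcases j with _ | j
    · have := step x 0 (fun _ => 1) (fun t => q ^ ((x - t) * (y - t))) (fun t => pow_mem hqL _)
        (by lia) (fun k => by rw [one_mul, baileyKernel_mul_baileyKernel hq])
      simpa using this
    · simp only [pow_eq]
      exact step x j _ (fun t => q ^ (t * (t + 1))) (fun t => pow_mem hqL _)
        (by simp at hj; lia) (fun k => pow_mul_baileyKernel_mul_baileyKernel hq x y k)

theorem chainProd_map_range (k M : ℕ) : ∀ N : ℕ → ℕ,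
    chainProd q k ((List.range (M + 1)).map N) =
      (∏ i ∈ Finset.range M, qFactAt q (N i + N (i + 1) + 1)) * qFactAt q (N M) *
        ∏ i ∈ Finset.range (M + 1), baileyKernel q (N i) k := by
  induction M with
  | zero => intro N; simp [chainProd, headSucc, mul_comm]
  | succ M ih =>
    intro N
    have h := ih (fun i => N (i + 1))
    rw [List.range_succ_eq_map, List.map_cons, List.map_map, chainProd]
    have e : (List.range (M + 1)).map (N ∘ Nat.succ) =
        (List.range (M + 1)).map (fun i => N (i + 1)) := rfl
    have e' : headSucc ((List.range (M + 1)).map (fun i => N (i + 1))) = N 1 + 1 := by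
      rw [List.range_succ_eq_map]; rfl
    rw [e, e', h, Finset.prod_range_succ' (fun i => qFactAt q (N i + N (i + 1) + 1)),
      Finset.prod_range_succ' (fun i => baileyKernel q (N i) k), ← add_assoc]
    simp only [zero_add]
    ring

theorem intEvalAt_qBinom_sub (hq : ∀ n, qIntAt q (n + 1) ≠ 0) (a b k : ℕ) :
    intEvalAt q (qBinom (a + b + 1) ((a : ℤ) - k)) =
      qFactAt q (a + b + 1) * (invFactSub q a k * (qFactAt q (b + k + 1))⁻¹) := by
  rcases le_or_gt k a with h | h
  · have e : ((a : ℤ) - k).toNat = a - k := by lia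
    rw [qBinom, if_pos (by lia), e]
    change qBinomAt q _ _ = _
    rw [qBinomAt_eq_mul_inv hq _ (a - k) (b + k + 1) (by lia), invFactSub, if_pos h, mul_assoc]
  · rw [qBinom, if_neg (by lia), invFactSub_of_lt q h]
    simp

/-- Cyclicity pairs `1/[n_i-k]!` with `1/[n_i+k+1]!`, and splitting the wrap-around factorial gives
the modulus. -/
theorem prod_intEvalAt_qBinom (hq : ∀ n, qIntAt q (n + 1) ≠ 0) (M k : ℕ) (N : ℕ → ℕ)
    (hN : N (M + 1) = N 0) :
    ∏ i ∈ Finset.range (M + 1), intEvalAt q (qBinom (N i + N (i + 1) + 1) ((N i : ℤ) - k)) =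
      qIntAt q (N 0 + N M + 1) * qBinomAt q (N 0 + N M) (N 0) *
        (qFactAt q (N 0) * chainProd q k ((List.range (M + 1)).map N)) := by
  simp only [intEvalAt_qBinom_sub hq]
  have h1 : ∏ i ∈ Finset.range (M + 1), (qFactAt q (N (i + 1) + k + 1))⁻¹ =
      ∏ i ∈ Finset.range (M + 1), (qFactAt q (N i + k + 1))⁻¹ := by
    rw [Finset.prod_range_succ, hN, Finset.prod_range_succ' (fun i => (qFactAt q (N i + k + 1))⁻¹)]
  have h2 := qBinomAt_mul_qFactAt q (N 0 + N M) (N 0) (N M) rfl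
  have e : N M + N 0 + 1 = N 0 + N M + 1 := by lia
  rw [chainProd_map_range, Finset.prod_mul_distrib, Finset.prod_mul_distrib, h1,
    ← Finset.prod_mul_distrib, Finset.prod_range_succ _ M, hN, e, qFactAt_succ, ← h2]
  simp only [baileyKernel]
  ring

theorem isMultipleIn_cyclic_sum {L : Subring K} (hq : ∀ n, qIntAt q (n + 1) ≠ 0) (hqL : q ∈ L)
    {a b : ℕ} (ha : a ≤ 1) (hb : b ≤ 1) {w : ℕ → K}
    (hw : ∀ n, IsMultipleIn L (qIntAt q n ^ (a + b)) (kernelSum q w n))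
    (M j : ℕ) (hj : j ≤ M + 1) (N : ℕ → ℕ) (hN : N (M + 1) = N 0) :
    IsMultipleIn L (qIntAt q (N 0 + N M + 1) * qBinomAt q (N 0 + N M) (N 0) *
        qIntAt q (N 0) ^ a * qIntAt q (N M) ^ b)
      (∑ k ∈ Finset.range (N 0 + 1), w k * q ^ (j * (k * (k + 1))) *
        ∏ i ∈ Finset.range (M + 1),
          intEvalAt q (qBinom (N i + N (i + 1) + 1) ((N i : ℤ) - k))) := by
  have h := isMultipleIn_chainSum hq hqL ha hb hw ((List.range M).map (fun i => N (i + 1)))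
    (N 0) j (by simpa using hj)
  have e1 : ((List.range M).map (fun i => N (i + 1))).getLastD (N 0) = N M := by
    rcases M with _ | M
    · simp
    · simp [List.range_succ]
  have e2 : (List.range (M + 1)).map N = N 0 :: (List.range M).map (fun i => N (i + 1)) := by
    rw [List.range_succ_eq_map, List.map_cons, List.map_map]; rfl
  rw [e1] at h
  obtain ⟨p, hp, h⟩ := h
  refine ⟨p, hp, ?_⟩
  simp only [prod_intEvalAt_qBinom hq M _ N hN, e2]
  rw [mul_assoc (_ * qBinomAt q _ _), mul_assoc (_ * qBinomAt q _ _), ← h, chainSum,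
    Finset.mul_sum, Finset.mul_sum]
  exact Finset.sum_congr rfl fun k _ => by ring

end Chain

/-! ### From the fraction field back to Laurent polynomials. -/

section Transfer

/-- The variable `q` in the field of fractions of the Laurent polynomials. -/
noncomputable def laurentVar : FractionRing ℤ[T;T⁻¹] :=
  algebraMap ℤ[T;T⁻¹] (FractionRing ℤ[T;T⁻¹]) (LaurentPolynomial.T 1)

theorem algebraMap_T (e : ℤ) :
    algebraMap ℤ[T;T⁻¹] (FractionRing ℤ[T;T⁻¹]) (LaurentPolynomial.T e) = laurentVar ^ e := by
  have nat : ∀ n : ℕ, algebraMap ℤ[T;T⁻¹] (FractionRing ℤ[T;T⁻¹]) (LaurentPolynomial.T n) =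
      laurentVar ^ n := fun n => by
    rw [laurentVar, ← map_pow, LaurentPolynomial.T_pow, mul_one]
  obtain ⟨n, rfl | rfl⟩ := e.eq_nat_or_neg
  · rw [nat, zpow_natCast]
  · rw [zpow_neg, zpow_natCast, ← nat]
    apply eq_inv_of_mul_eq_one_left
    rw [← map_mul, ← LaurentPolynomial.T_add, neg_add_cancel, LaurentPolynomial.T_zero, map_one]

theorem laurentVar_ne_zero : laurentVar ≠ 0 := by
  intro h
  have h1 := algebraMap_T (-1 + 1)
  rw [LaurentPolynomial.T_add, map_mul, algebraMap_T 1, zpow_one, h] at h1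
  simp at h1

theorem algebraMap_toLaurent (p : ℤ[X]) :
    algebraMap ℤ[T;T⁻¹] (FractionRing ℤ[T;T⁻¹]) (toLaurent p) = intEvalAt laurentVar p := by
  have : ((algebraMap ℤ[T;T⁻¹] (FractionRing ℤ[T;T⁻¹])).comp toLaurent) =
      intEvalAt laurentVar := by
    apply Polynomial.ringHom_ext
    · intro a
      simp
    · simp [laurentVar]
  exact DFunLike.congr_fun this p

theorem intEvalAt_qInt {K : Type*} [Field K] (q : K) (n : ℕ) : intEvalAt q (qInt n) = qIntAt q n := by
  simp [qInt, qIntAt]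

theorem qIntAt_laurentVar_ne_zero (n : ℕ) : qIntAt laurentVar (n + 1) ≠ 0 := by
  rw [← intEvalAt_qInt, ← algebraMap_toLaurent]
  intro h
  rw [map_eq_zero_iff _ (IsFractionRing.injective ℤ[T;T⁻¹] _),
    map_eq_zero_iff _ toLaurent_injective] at h
  -- At `q = 1` the `q`-integer takes the value `n + 1`.
  have h1 := congrArg (Polynomial.eval 1) h
  simp [qInt] at h1
  lia

theorem laurentModEq_zero_of_isMultipleIn {D : ℤ[X]} {A : ℤ[T;T⁻¹]}
    (h : IsMultipleIn (algebraMap ℤ[T;T⁻¹] (FractionRing ℤ[T;T⁻¹])).range (intEvalAt laurentVar D)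
      (algebraMap ℤ[T;T⁻¹] (FractionRing ℤ[T;T⁻¹]) A)) : LaurentModEq D A 0 := by
  obtain ⟨_, ⟨p, rfl⟩, h⟩ := h
  refine ⟨p, ?_⟩
  rw [← algebraMap_toLaurent, ← map_mul] at h
  rw [sub_zero]
  exact IsFractionRing.injective ℤ[T;T⁻¹] _ h

theorem laurentVar_mem : laurentVar ∈ (algebraMap ℤ[T;T⁻¹] (FractionRing ℤ[T;T⁻¹])).range :=
  ⟨_, rfl⟩

theorem inv_laurentVar_mem :
    laurentVar⁻¹ ∈ (algebraMap ℤ[T;T⁻¹] (FractionRing ℤ[T;T⁻¹])).range :=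
  ⟨LaurentPolynomial.T (-1), by rw [algebraMap_T, zpow_neg_one]⟩

/-- The pair `v`, `p` splits the weight into a Laurent and a polynomial part, so that one statement
covers both congruences. -/
theorem laurentModEq_cyclic_sum {a b : ℕ} (ha : a ≤ 1) (hb : b ≤ 1)
    {w : ℕ → FractionRing ℤ[T;T⁻¹]}
    (hw : ∀ n, IsMultipleIn (algebraMap ℤ[T;T⁻¹] (FractionRing ℤ[T;T⁻¹])).range
      (qIntAt laurentVar n ^ (a + b)) (kernelSum laurentVar w n))
    (m : ℕ) (hm : 1 ≤ m) (n : ℕ → ℕ) (hcyc : n (m + 1) = n 1) (j : ℕ) (hj : j ≤ m)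
    (v : ℕ → ℤ[T;T⁻¹]) (p : ℕ → ℤ[X])
    (hv : ∀ k, algebraMap ℤ[T;T⁻¹] (FractionRing ℤ[T;T⁻¹]) (v k) * intEvalAt laurentVar (p k) =
      w k * laurentVar ^ (j * (k * (k + 1)))) :
    LaurentModEq (qInt (n 1 + n m + 1) * qBinom (n 1 + n m) (n 1) * qInt (n 1) ^ a * qInt (n m) ^ b)
      (∑ k ∈ Finset.range (n 1 + 1), v k * toLaurent (p k *
        ∏ i ∈ Finset.Icc 1 m, qBinom (n i + n (i + 1) + 1) ((n i : ℤ) - k))) 0 := by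
  obtain ⟨M, rfl⟩ := Nat.exists_eq_add_of_le' hm
  apply laurentModEq_zero_of_isMultipleIn
  have h := isMultipleIn_cyclic_sum qIntAt_laurentVar_ne_zero laurentVar_mem ha hb hw M j hj
    (fun i => n (i + 1)) hcyc
  have hB : intEvalAt laurentVar (qBinom (n 1 + n (M + 1)) (n 1)) =
      qBinomAt laurentVar (n 1 + n (M + 1)) (n 1) := by
    rw [qBinom, if_pos (by lia), Int.toNat_natCast]; rfl
  convert h using 1
  · simp only [map_mul, map_pow, intEvalAt_qInt, hB, zero_add]
  · rw [map_sum]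
    refine Finset.sum_congr rfl fun k _ => ?_
    rw [map_mul, algebraMap_toLaurent, map_mul, ← mul_assoc, hv, map_prod,
      ← Finset.Ico_add_one_right_eq_Icc,
      Finset.prod_Ico_eq_prod_range]
    congr 1
    refine Finset.prod_congr rfl fun i _ => ?_
    simp only [add_comm 1 i]

end Transfer

theorem theorem1p2 (m : ℕ) (hm : 1 ≤ m) (n : ℕ → ℕ)
    (hpos : ∀ i ∈ Finset.Icc 1 m, 0 < n i) (hcyc : n (m + 1) = n 1)
    (j r : ℕ) (hj : j ≤ m) :
    LaurentModEq
      (qInt (n 1 + n m + 1) * qBinom (n 1 + n m) (n 1) *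
        qInt (n 1) ^ min 1 r * qInt (n m) ^ min 1 (r.choose 2))
      (∑ k ∈ Finset.range (n 1 + 1),
        LaurentPolynomial.T ((j : ℤ) * ((k : ℤ) ^ 2 + k) - ((r : ℤ) + 1) * k) *
          toLaurent (qInt (2 * k + 1) * qInt k ^ r * qInt (k + 1) ^ r *
            ∏ i ∈ Finset.Icc 1 m, qBinom (n i + n (i + 1) + 1) ((n i : ℤ) - k)))
      0 ∧
    LaurentModEq
      (qInt (n 1 + n m + 1) * qBinom (n 1 + n m) (n 1) *
        qInt (n 1) ^ min 1 r * qInt (n m) ^ min 1 r)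
      (∑ k ∈ Finset.range (n 1 + 1),
        (-1) ^ k *
          LaurentPolynomial.T
            ((k.choose 2 : ℤ) + (j : ℤ) * ((k : ℤ) ^ 2 + k) - (r : ℤ) * k) *
          toLaurent (qInt (2 * k + 1) * qInt k ^ r * qInt (k + 1) ^ r *
            ∏ i ∈ Finset.Icc 1 m, qBinom (n i + n (i + 1) + 1) ((n i : ℤ) - k)))
      0 := by
  have q0 := laurentVar_ne_zero
  have hq := qIntAt_laurentVar_ne_zero
  constructor
  · refine laurentModEq_cyclic_sum (min_le_left _ _) (min_le_left _ _)
      (isMultipleIn_kernelSum_mul_pow q0 hq laurentVar_mem inv_laurentVar_mem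
        (w := fun k => (laurentVar ^ k)⁻¹ * qIntAt laurentVar (2 * k + 1)) (fun n => ?_) r)
      m hm n hcyc j hj _ _ fun k => ?_
    -- The base value `q^(-n)` requires `q⁻¹` in the cofactor ring.
    · rw [kernelSum_inv_pow q0 hq, ← inv_pow]
      exact pow_mem inv_laurentVar_mem n
    · have e : (j : ℤ) * ((k : ℤ) ^ 2 + k) - ((r : ℤ) + 1) * k =
          ((j * (k * (k + 1)) : ℕ) : ℤ) - ((k * r + k : ℕ) : ℤ) := by
        push_cast; ring
      rw [algebraMap_T, e, zpow_sub₀ q0, zpow_natCast, zpow_natCast]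
      simp only [map_mul, map_pow, intEvalAt_qInt, qPronic, mul_pow, inv_pow, pow_add, pow_mul]
      field_simp
  · refine laurentModEq_cyclic_sum (min_le_left _ _) (min_le_left _ _)
      (isMultipleIn_kernelSum_mul_pow_of_eq_zero q0 hq laurentVar_mem inv_laurentVar_mem
        (w := fun k => (-1) ^ k * laurentVar ^ k.choose 2 * qIntAt laurentVar (2 * k + 1)) ?_
        (kernelSum_neg_one_pow hq) r)
      m hm n hcyc j hj _ _ fun k => ?_
    · simp [kernelSum, baileyKernel, invFactSub, qFactAt, one_mem]
    · have e : (k.choose 2 : ℤ) + (j : ℤ) * ((k : ℤ) ^ 2 + k) - (r : ℤ) * k =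
          ((k.choose 2 + j * (k * (k + 1)) : ℕ) : ℤ) - ((k * r : ℕ) : ℤ) := by
        push_cast; ring
      rw [map_mul, algebraMap_T, e, zpow_sub₀ q0, zpow_natCast, zpow_natCast]
      simp only [map_mul, map_pow, map_neg, map_one, intEvalAt_qInt, qPronic, mul_pow, inv_pow,
        pow_add, pow_mul]
      field_simp
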